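/- **Graph and transformation.** Let $n\ge 2$ and let $\mathcal G$ be a strongly connected digraph on $\{1,\dots,n\}$ with adjacency entries $a_{ik}=1$ if $(i,k)$ is an edge and $a_{ik}=0$ otherwise. Let $\mathcal L$ be its in-degree Laplacian, $(\mathcal L x)_i=\sum_{k}a_{ki}(x_i-x_k)$, so that $\mathcal L\mathbf 1_n=0$. Let $\mathcal T\in\mathbb R^{n\times n}$ be any nonsingular matrix with first column $\frac1{\sqrt n}\mathbf 1_n$ such that $\mathcal T^{-1}\mathcal L\mathcal T=\begin{bmatrix}0&0\\0&\bar{\mathcal L}\end{bmatrix}$ with $\bar{\mathcal L}\in\mathbb R^{(n-1)\times(n-1)}$ (for instance, when $\mathcal L$ is diagonalizable over $\mathbb R$, the columns of $\mathcal T$ are eigenvectors of $\mathcal L$ and $\bar{\mathcal L}=\mathrm{diag}(\lambda_2,\dots,\lambda_n)$). **Matrices.** Let $T_2\ge T_1>0$, $\mu>0$, $h\in\mathbb R$, $\gamma>0$, let $I=I_{n-1}$, and put $$A_{f_1}=\begin{bmatrix}0&1\\0&h\end{bmatrix},\quad A_{f_2}=\begin{bmatrix}0&I\\0&hI\end{bmatrix},\quad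 A_{f_3}=\begin{bmatrix}0&\mu\\-1&-1\end{bmatrix},\quad A_{f_4}=\begin{bmatrix}0&\mu I\\-I&-I\end{bmatrix},$$ $$B_{f_1}=A_{g_1}=\begin{bmatrix}1&0\\0&0\end{bmatrix},\quad B_{f_2}=\begin{bmatrix}I&0\\0&0\end{bmatrix},\quad A_{g_2}=\begin{bmatrix}I&0\\-\gamma\bar{\mathcal L}&0\end{bmatrix}.$$ **System.** The perturbed hybrid system $\widetilde{\mathcal H}_m$ has state $\chi=(\bar z_1,\bar z_2,\bar w_1,\bar w_2,\tau)\in\mathbb R^2\times\mathbb R^{2(n-1)}\times\mathbb R^2\times\mathbb R^{2(n-1)}\times[0,T_2]=:\mathcal X$ and input $\bar m_e\in\mathbb R^n$ (the communication noise $m_e$ in the coordinates $\bar m_e=\mathcal T^{-1}m_e$). Its flows, allowed for $\chi\in\mathcal X$, are $$\dot{\bar z}_1=A_{f_1}\bar z_1+B_{f_1}\bar w_1,\quad \dot{\bar z}_2=A_{f_2}\bar z_2+B_{f_2}\bar w_2,\quad \dot{\bar w}_1=A_{f_3}\bar w_1,\quad \dot{\bar w}_2=A_{f_4}\bar w_2,\quad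 \dot\tau=-1,$$ and its jumps, allowed for $\chi\in\mathcal X$ with $\tau=0$, are $$\bar z_1^+=A_{g_1}\bar z_1,\quad \bar z_2^+=A_{g_2}\bar z_2-\begin{bmatrix}0\\ \gamma\bar{\mathcal L}\,(\bar m_{e,2},\dots,\bar m_{e,n})^\top\end{bmatrix},\quad \bar w_1^+=\bar w_1,\quad \bar w_2^+=\bar w_2,\quad \tau^+\in[T_1,T_2].$$ Let $\widetilde{\mathcal A}_\varepsilon=\{\chi\in\mathcal X:\bar z_1=(e^*,0)\text{ for some }e^*\in\mathbb R,\ \bar z_2=0,\ \bar w_1=0,\ \bar w_2=0\}$. **Hypotheses.** Let $P_1$, $P_3$ (of size $2(n-1)$) and $P_2$ (of size $2$) be symmetric positive definite, and let $\epsilon,\beta_1,\beta_2>0$ be such that $$P_2A_{f_3}+A_{f_3}^\top P_2\preceq-\beta_1I_2,\qquad P_3A_{f_4}+A_{f_4}^\top P_3\preceq-\beta_2I_{2(n-1)}.$$ Write $Q(\nu)=\exp(A_{f_2}^\top\nu)P_1\exp(A_{f_2}\nu)$, and suppose that $$A_{g_2}^\top Q(\nu)A_{g_2}-P_1\prec0\quad\text{for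 all }\nu\in[T_1,T_2],\qquad \left|\exp\Big(\frac{\bar\kappa_1}{\alpha_2}T_2\Big)\Big(1-\frac{\bar\kappa_2}{\alpha_2}\Big)\right|<1,$$ where $|\cdot|$ of a matrix is the spectral norm, $$\kappa_1=2\max_{\nu\in[0,T_2]}|Q(\nu)|,\qquad \bar\kappa_1=\max\Big\{\frac{\kappa_1}{2\epsilon},\frac{\kappa_1\epsilon}{2}-\beta_2\Big\},\qquad \bar\kappa_2=\min\{1,\kappa_2\},$$ $$0<\kappa_2<-\min_{\nu\in[T_1,T_2]}\lambda_{\min}\big(A_{g_2}^\top Q(\nu)A_{g_2}-P_1\big),$$ $$\alpha_2=\max_{\nu\in[0,T_2]}\max\{e^{2h\nu},\lambda_{\max}(Q(\nu)),\lambda_{\max}(P_2),\lambda_{\max}(P_3)\}.$$ **Conclusion.** Then $\widetilde{\mathcal H}_m$ with input $\bar m_e$ is input-to-state stable with respect to $\widetilde{\mathcal A}_\varepsilon$: there are $\beta\in\mathcal{KL}$ and $\kappa\in\mathcal K$ such that every solution pair $(\phi,\bar m_e)$ satisfies $$|\phi(t,j)|_{\widetilde{\mathcal A}_\varepsilon}\le\max\{\beta(|\phi(0,0)|_{\widetilde{\mathcal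 A}_\varepsilon},t+j),\ \kappa(|\bar m_e|_\infty)\}\quad\text{for all }(t,j)\in\operatorname{dom}\phi.$$ Here $|\cdot|_{\widetilde{\mathcal A}_\varepsilon}$ is the Euclidean distance to $\widetilde{\mathcal A}_\varepsilon$, and $|\bar m_e|_\infty$ is the larger of the essential supremum of $|\bar m_e|$ along flows and its supremum over jump times. -/

import Mathlib

open MeasureTheory

noncomputable section

namespace HyNTP

/-! ### Hybrid systems with inputs and input-to-state stability -/

/-- Data `(C, f, D, G)` of a hybrid system with state space `E` and input space `U`:
`x ∈ C, ẋ = f (x, u)` and `x ∈ D, x⁺ ∈ G (x, u)`. -/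
structure HybridSystem (E U : Type*) where
  /-- flow set -/
  C : Set E
  /-- flow map -/
  f : E → U → E
  /-- jump set -/
  D : Set E
  /-- set-valued jump map -/
  G : E → U → Set E

/-- Hybrid time domains: every truncation to `[0, T] × {0, …, J}`, with `(T, J)` in the domain, is
`⋃_{j ≤ J} [t_j, t_{j+1}] × {j}` for some `0 = t_0 ≤ t_1 ≤ … ≤ t_{J+1}`. -/
def IsHybridTimeDomain (dom : Set (ℝ × ℕ)) : Prop :=
  (∀ p ∈ dom, 0 ≤ p.1) ∧
  ∀ T : ℝ, ∀ J : ℕ, (T, J) ∈ dom →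
    ∃ t : ℕ → ℝ, t 0 = 0 ∧ (∀ j ≤ J, t j ≤ t (j + 1)) ∧
      dom ∩ {p | 0 ≤ p.1 ∧ p.1 ≤ T ∧ p.2 ≤ J} =
        {p | p.2 ≤ J ∧ t p.2 ≤ p.1 ∧ p.1 ≤ t (p.2 + 1)}

/-- The slice `I^j = {t : (t, j) ∈ dom}`. -/
def slice (dom : Set (ℝ × ℕ)) (j : ℕ) : Set ℝ := {t | (t, j) ∈ dom}

/-- Hybrid arcs: functions on a hybrid time domain that are locally absolutely continuous on each
slice. (The values of `φ` outside `dom` are irrelevant.) -/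
def IsHybridArc {E : Type*} [PseudoMetricSpace E] (dom : Set (ℝ × ℕ)) (φ : ℝ → ℕ → E) : Prop :=
  IsHybridTimeDomain dom ∧
  ∀ j : ℕ, ∀ a ∈ slice dom j, ∀ b ∈ slice dom j,
    AbsolutelyContinuousOnInterval (fun t => φ t j) a b

/-- `(φ, m)` is a solution pair, with common domain `dom`, of the hybrid system `H`. The input is an
arbitrary function on the domain, so that measurable, locally essentially bounded hybrid inputs
are included. -/
structure IsSolutionPair {E U : Type*} [NormedAddCommGroup E] [NormedSpace ℝ E]
    (H : HybridSystem E U) (dom : Set (ℝ × ℕ)) (φ : ℝ → ℕ → E) (m : ℝ → ℕ → U) : Prop where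
  nonempty : dom.Nonempty
  arc : IsHybridArc dom φ
  init : φ 0 0 ∈ closure H.C ∪ H.D
  flow_mem : ∀ j : ℕ, ∀ t ∈ interior (slice dom j), φ t j ∈ H.C
  flow_deriv : ∀ j : ℕ, ∀ᵐ t : ℝ, t ∈ interior (slice dom j) →
    HasDerivAt (fun s => φ s j) (H.f (φ t j) (m t j)) t
  jump : ∀ t : ℝ, ∀ j : ℕ, (t, j) ∈ dom → (t, j + 1) ∈ dom →
    φ t j ∈ H.D ∧ φ t (j + 1) ∈ H.G (φ t j) (m t j)

/-- The `L^∞` norm `|m|_∞` of a hybrid input: the essential supremum along flows together with the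
supremum over jump times. It never exceeds the plain supremum of `|m|` over the domain. -/
def hybridSupNorm {U : Type*} [NormedAddCommGroup U] (dom : Set (ℝ × ℕ)) (m : ℝ → ℕ → U) :
    ENNReal :=
  max (⨆ j : ℕ, essSup (fun t => ‖m t j‖ₑ) (volume.restrict (slice dom j)))
    (⨆ (t : ℝ) (j : ℕ) (_ : (t, j) ∈ dom ∧ (t, j + 1) ∈ dom), ‖m t j‖ₑ)

/-- Class-`𝒦` functions on `[0, ∞)`. -/
def IsClassK (κ : ℝ → ℝ) : Prop :=
  ContinuousOn κ (Set.Ici 0) ∧ StrictMonoOn κ (Set.Ici 0) ∧ κ 0 = 0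

/-- Class-`𝒦ℒ` functions on `[0, ∞) × [0, ∞)`. -/
def IsClassKL (β : ℝ → ℝ → ℝ) : Prop :=
  ContinuousOn (fun p : ℝ × ℝ => β p.1 p.2) (Set.Ici 0 ×ˢ Set.Ici 0) ∧
  (∀ s, 0 ≤ s → IsClassK (fun r => β r s)) ∧
  (∀ r, 0 ≤ r → AntitoneOn (β r) (Set.Ici 0) ∧ Filter.Tendsto (β r) Filter.atTop (nhds 0))

/-- Input-to-state stability of `H` with respect to the set `A`. An input with `|m|_∞ = ∞` imposes
nothing, the bound being then infinite. -/
def IsISS {E U : Type*} [NormedAddCommGroup E] [NormedSpace ℝ E] [NormedAddCommGroup U]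
    (H : HybridSystem E U) (A : Set E) : Prop :=
  ∃ (β : ℝ → ℝ → ℝ) (κ : ℝ → ℝ), IsClassKL β ∧ IsClassK κ ∧
    ∀ (dom : Set (ℝ × ℕ)) (φ : ℝ → ℕ → E) (m : ℝ → ℕ → U),
      IsSolutionPair H dom φ m → hybridSupNorm dom m ≠ ⊤ →
      ∀ (t : ℝ) (j : ℕ), (t, j) ∈ dom →
        Metric.infDist (φ t j) A ≤
          max (β (Metric.infDist (φ 0 0) A) (t + j)) (κ (hybridSupNorm dom m).toReal)

/-! ### Digraphs and their Laplacian -/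

/-- Any node can be reached from any other one along directed edges. -/
def StronglyConnected {V : Type*} (G : Digraph V) : Prop :=
  ∀ i k : V, i ≠ k → Relation.TransGen G.Adj i k

open Classical in
/-- `0`-`1` adjacency matrix, `a_{ik} = 1` iff `(i, k)` is an edge. -/
def adjMatrix {V : Type*} (G : Digraph V) : Matrix V V ℝ :=
  Matrix.of fun i k => if G.Adj i k then 1 else 0

open Classical in
/-- In-degree Laplacian, `(ℒ x)_i = ∑_{k ∈ 𝒩(i)} (x_i - x_k)` with `𝒩(i) = {k : (k, i) is an edge}`;
in particular `ℒ 1 = 0`. -/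
def laplacian {V : Type*} [Fintype V] (G : Digraph V) : Matrix V V ℝ :=
  Matrix.diagonal (fun i => ∑ k, adjMatrix G k i) - (adjMatrix G).transpose

/-- The `(d+1) × (d+1)` block-diagonal matrix `diag(0, M)`. -/
def zeroBlock {d : ℕ} (M : Matrix (Fin d) (Fin d) ℝ) : Matrix (Fin (d + 1)) (Fin (d + 1)) ℝ :=
  Matrix.of fun i k => Fin.cases 0 (fun i' => Fin.cases 0 (fun k' => M i' k') k) i

/-- `𝒯` is nonsingular, its first column is `1 / √n` times the vector of ones, and
`𝒯⁻¹ ℒ 𝒯 = diag(0, Lb)`, where `n = d + 1` is the number of nodes. -/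
structure IsReducingTransform {d : ℕ} (G : Digraph (Fin (d + 1)))
    (𝒯 : Matrix (Fin (d + 1)) (Fin (d + 1)) ℝ) (Lb : Matrix (Fin d) (Fin d) ℝ) : Prop where
  isUnit_det : IsUnit 𝒯.det
  first_col : ∀ i, 𝒯 i 0 = 1 / √((d : ℝ) + 1)
  similar : 𝒯⁻¹ * laplacian G * 𝒯 = zeroBlock Lb

/-! ### The closed-loop system in the transformed coordinates

There are `n = d + 1` nodes. -/

/-- Index type of `ℝ^{2(n-1)}`, seen as `ℝ^{n-1} × ℝ^{n-1}`. -/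
abbrev Idx2 (d : ℕ) : Type := Fin d ⊕ Fin d

/-- Index type of the state `χ = (z₁, z₂, w₁, w₂, τ)`. -/
abbrev StateIdx (d : ℕ) : Type := Fin 2 ⊕ Idx2 d ⊕ Fin 2 ⊕ Idx2 d ⊕ Unit

/-- `ℝ² × ℝ^{2(n-1)} × ℝ² × ℝ^{2(n-1)} × ℝ` with the Euclidean norm. -/
abbrev State (d : ℕ) : Type := EuclideanSpace ℝ (StateIdx d)

/-- Noise values `m̄_e ∈ ℝⁿ`. -/
abbrev Noise (d : ℕ) : Type := EuclideanSpace ℝ (Fin (d + 1))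

namespace State

variable {d : ℕ}

/-- `z₁ = (ē₁, η̄₁)` -/
def z₁ (χ : State d) : Fin 2 → ℝ := fun i => χ (Sum.inl i)

/-- `z₂ = (ē₂, …, ē_n, η̄₂, …, η̄_n)` -/
def z₂ (χ : State d) : Idx2 d → ℝ := fun i => χ (Sum.inr (Sum.inl i))

/-- `w₁ = (ε̄_{a,1}, ε̄_{τ,1})` -/
def w₁ (χ : State d) : Fin 2 → ℝ := fun i => χ (Sum.inr (Sum.inr (Sum.inl i)))

/-- `w₂ = (ε̄_{a,2}, …, ε̄_{a,n}, ε̄_{τ,2}, …, ε̄_{τ,n})` -/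
def w₂ (χ : State d) : Idx2 d → ℝ := fun i => χ (Sum.inr (Sum.inr (Sum.inr (Sum.inl i))))

/-- the timer -/
def τ (χ : State d) : ℝ := χ (Sum.inr (Sum.inr (Sum.inr (Sum.inr ()))))

/-- Assemble a state from its blocks. -/
def mk (z₁ : Fin 2 → ℝ) (z₂ : Idx2 d → ℝ) (w₁ : Fin 2 → ℝ) (w₂ : Idx2 d → ℝ) (τ : ℝ) : State d :=
  WithLp.toLp 2
    (Sum.elim z₁ (Sum.elim z₂ (Sum.elim w₁ (Sum.elim w₂ (fun _ => τ)))))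

end State

/-- `A_{f₁}` -/
def Af₁ (h : ℝ) : Matrix (Fin 2) (Fin 2) ℝ := !![0, 1; 0, h]

/-- `A_{f₂}` -/
def Af₂ (d : ℕ) (h : ℝ) : Matrix (Idx2 d) (Idx2 d) ℝ := Matrix.fromBlocks 0 1 0 (h • 1)

/-- `A_{f₃}` -/
def Af₃ (μ : ℝ) : Matrix (Fin 2) (Fin 2) ℝ := !![0, μ; -1, -1]

/-- `A_{f₄}` -/
def Af₄ (d : ℕ) (μ : ℝ) : Matrix (Idx2 d) (Idx2 d) ℝ := Matrix.fromBlocks 0 (μ • 1) (-1) (-1)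

/-- `B_{f₁}` -/
def Bf₁ : Matrix (Fin 2) (Fin 2) ℝ := !![1, 0; 0, 0]

/-- `B_{f₂}` -/
def Bf₂ (d : ℕ) : Matrix (Idx2 d) (Idx2 d) ℝ := Matrix.fromBlocks 1 0 0 0

/-- `A_{g₁}` -/
def Ag₁ : Matrix (Fin 2) (Fin 2) ℝ := !![1, 0; 0, 0]

/-- `A_{g₂}` -/
def Ag₂ {d : ℕ} (γ : ℝ) (Lb : Matrix (Fin d) (Fin d) ℝ) : Matrix (Idx2 d) (Idx2 d) ℝ :=
  Matrix.fromBlocks 1 0 (-(γ • Lb)) 0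

/-- The noise contribution `(0, γ Lb (m̄_{e,2}, …, m̄_{e,n})) ∈ ℝ^{2(n-1)}` at jumps. -/
def noiseTerm {d : ℕ} (γ : ℝ) (Lb : Matrix (Fin d) (Fin d) ℝ) (m : Noise d) : Idx2 d → ℝ :=
  Sum.elim 0 ((γ • Lb).mulVec fun i => m i.succ)

/-- The hybrid system with communication noise as input: flow set `τ ∈ [0, T₂]`, jump set
`τ = 0`. -/
def noisySystem {d : ℕ} (T₁ T₂ μ h γ : ℝ) (Lb : Matrix (Fin d) (Fin d) ℝ) :
    HybridSystem (State d) (Noise d) where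
  C := {χ | χ.τ ∈ Set.Icc 0 T₂}
  f := fun χ _ => State.mk
    ((Af₁ h).mulVec χ.z₁ + Bf₁.mulVec χ.w₁)
    ((Af₂ d h).mulVec χ.z₂ + (Bf₂ d).mulVec χ.w₂)
    ((Af₃ μ).mulVec χ.w₁)
    ((Af₄ d μ).mulVec χ.w₂)
    (-1)
  D := {χ | χ.τ ∈ Set.Icc 0 T₂ ∧ χ.τ = 0}
  G := fun χ m => {g | ∃ ν ∈ Set.Icc T₁ T₂, g = State.mk
    (Ag₁.mulVec χ.z₁)
    ((Ag₂ γ Lb).mulVec χ.z₂ - noiseTerm γ Lb m)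
    χ.w₁
    χ.w₂
    ν}

/-- The synchronization set: `z₁ = (e*, 0)` for some real `e*`, `z₂ = 0`, `w₁ = 0`, `w₂ = 0`,
`τ ∈ [0, T₂]`. -/
def syncSet (d : ℕ) (T₂ : ℝ) : Set (State d) :=
  {χ | χ.τ ∈ Set.Icc 0 T₂ ∧ (∃ e : ℝ, χ.z₁ = ![e, 0]) ∧ χ.z₂ = 0 ∧ χ.w₁ = 0 ∧ χ.w₂ = 0}

/-! ### Constants in the design conditions -/

section constants

variable {ι : Type*} [Fintype ι] [DecidableEq ι]

/-- Smallest eigenvalue (of a symmetric matrix). -/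
def lamMin (M : Matrix ι ι ℝ) : ℝ := sInf (spectrum ℝ M)

/-- Largest eigenvalue (of a symmetric matrix). -/
def lamMax (M : Matrix ι ι ℝ) : ℝ := sSup (spectrum ℝ M)

/-- Spectral norm `|M| = max {√|λ| : λ an eigenvalue of Mᵀ M}`. -/
def specNorm (M : Matrix ι ι ℝ) : ℝ :=
  sSup ((fun l : ℝ => √|l|) '' spectrum ℝ (M.transpose * M))

end constants

/-- `exp(A_{f₂}ᵀ ν) P₁ exp(A_{f₂} ν)` -/
def flowGram {d : ℕ} (h : ℝ) (P₁ : Matrix (Idx2 d) (Idx2 d) ℝ) (ν : ℝ) :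
    Matrix (Idx2 d) (Idx2 d) ℝ :=
  NormedSpace.exp (ν • (Af₂ d h).transpose) * P₁ * NormedSpace.exp (ν • Af₂ d h)

/-- `A_{g₂}ᵀ exp(A_{f₂}ᵀ ν) P₁ exp(A_{f₂} ν) A_{g₂} - P₁` -/
def jumpDiff {d : ℕ} (h γ : ℝ) (Lb : Matrix (Fin d) (Fin d) ℝ)
    (P₁ : Matrix (Idx2 d) (Idx2 d) ℝ) (ν : ℝ) : Matrix (Idx2 d) (Idx2 d) ℝ :=
  (Ag₂ γ Lb).transpose * flowGram h P₁ ν * Ag₂ γ Lb - P₁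

/-- `κ₁ = 2 max_{ν ∈ [0, T₂]} |exp(A_{f₂}ᵀ ν) P₁ exp(A_{f₂} ν)|` -/
def kappa₁ {d : ℕ} (T₂ h : ℝ) (P₁ : Matrix (Idx2 d) (Idx2 d) ℝ) : ℝ :=
  2 * sSup ((fun ν => specNorm (flowGram h P₁ ν)) '' Set.Icc 0 T₂)

/-- `-min_{ν ∈ [T₁, T₂]} λ_min(A_{g₂}ᵀ exp(A_{f₂}ᵀ ν) P₁ exp(A_{f₂} ν) A_{g₂} - P₁)`, the upper end of
the range of `κ₂` -/
def kappa₂Bound {d : ℕ} (T₁ T₂ h γ : ℝ) (Lb : Matrix (Fin d) (Fin d) ℝ)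
    (P₁ : Matrix (Idx2 d) (Idx2 d) ℝ) : ℝ :=
  -sInf ((fun ν => lamMin (jumpDiff h γ Lb P₁ ν)) '' Set.Icc T₁ T₂)

/-- `κ̄₁ = max {κ₁ / (2 ε), κ₁ ε / 2 - β₂}` -/
def kappaBar₁ {d : ℕ} (T₂ h : ℝ) (P₁ : Matrix (Idx2 d) (Idx2 d) ℝ) (ε β₂ : ℝ) : ℝ :=
  max (kappa₁ T₂ h P₁ / (2 * ε)) (kappa₁ T₂ h P₁ * ε / 2 - β₂)

/-- `α₂ = max_{ν ∈ [0, T₂]} {exp(2hν), λ_max(exp(A_{f₂}ᵀ ν) P₁ exp(A_{f₂} ν)), λ_max(P₂), λ_max(P₃)}` -/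
def alpha₂ {d : ℕ} (T₂ h : ℝ) (P₁ : Matrix (Idx2 d) (Idx2 d) ℝ) (P₂ : Matrix (Fin 2) (Fin 2) ℝ)
    (P₃ : Matrix (Idx2 d) (Idx2 d) ℝ) : ℝ :=
  sSup ((fun ν => max (Real.exp (2 * h * ν))
    (max (lamMax (flowGram h P₁ ν)) (max (lamMax P₂) (lamMax P₃)))) '' Set.Icc 0 T₂)

end HyNTP

end

/-! The system is a cascade with a timer, and one quadratic Lyapunov function handles all of it. Write
`η` for the second component of `z₁` and `Q(τ) = exp(A_{f₂}ᵀ τ) P₁ exp(A_{f₂} τ)`. The function is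
`V = e^{aτ} η² + e^{στ} z₂ᵀ Q(τ) z₂ + κ (w₁ᵀ P₂ w₁ + w₂ᵀ P₃ w₂)` (`lyap`).

Along flows, `exp(A_{f₂} τ) z₂` is constant apart from the forcing by `w₂`, so `z₂ᵀ Q(τ) z₂` neither
grows nor decays by itself; the weights `e^{aτ}` and `e^{στ}` provide decay because `τ` runs down,
and for large `κ` the decay of the `w₂` part, given by the Lyapunov inequality for `P₃`, absorbs the
forcing (`lyap_flow`). At jumps `η` is reset to zero, `w₁` and `w₂` are unchanged, and the strict
inequality `A_{g₂}ᵀ Q(ν) A_{g₂} - P₁ ≺ 0`, being uniform on the compact interval `[T₁, T₂]`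
(`exists_jump_margin`), leaves room both for resetting the weight to `e^{σν}` and for the noise, so
that `V` grows by at most a multiple of `|m̄_e|²` (`lyap_jump`).

Since the timer is at least `T₁` after a jump and zero before the next one, jumps are at least `T₁`
apart. Their contributions to `V` are therefore dominated by a geometric series, which gives
`V(t, j) ≤ e^{-ct} V(0, 0) + K |m̄_e|²` (`IsSolutionPair.lyapunov_bound`), and `j ≤ t / T₁ + 1` turns
decay in `t` into decay in `t + j` (`isISS_of_lyapunov`). Finally `V` is comparable to
`η² + |z₂|² + |w₁|² + |w₂|²`, which is the squared distance to the synchronization set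
(`infDist_syncSet_sq`). Solutions are only absolutely continuous, so the decay along flows goes
through the fundamental theorem of calculus for absolutely continuous functions. -/

namespace HyNTP

/-! ### Absolutely continuous functions -/

open Set in
lemma _root_.AbsolutelyContinuousOnInterval.comp_locallyLipschitz {X Y : Type*}
    [NormedAddCommGroup X] [PseudoMetricSpace Y] {f : ℝ → X} {g : X → Y} {a b : ℝ}
    (hf : AbsolutelyContinuousOnInterval f a b) (hg : LocallyLipschitz g) :
    AbsolutelyContinuousOnInterval (fun t => g (f t)) a b := by
  obtain ⟨K, hK⟩ := (hg.locallyLipschitzOn (s := f '' uIcc a b)).exists_lipschitzOnWith_of_compact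
    (isCompact_uIcc.image_of_continuousOn hf.uniformContinuousOn.continuousOn)
  have hlim := Filter.Tendsto.const_mul (K : ℝ) (show Filter.Tendsto _ _ _ from hf)
  rw [mul_zero] at hlim
  refine squeeze_zero' (.of_forall fun E => Finset.sum_nonneg fun i _ => dist_nonneg) ?_ hlim
  filter_upwards [Filter.mem_inf_of_right (Filter.mem_principal_self _)] with E hE
  rw [Finset.mul_sum]
  refine Finset.sum_le_sum fun i hi => ?_
  exact hK.dist_le_mul _ (mem_image_of_mem f (hE.1 i hi).1) _ (mem_image_of_mem f (hE.1 i hi).2)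

lemma le_of_ae_hasDerivAt_nonpos {u : ℝ → ℝ} {a b : ℝ} (hab : a ≤ b)
    (hu : AbsolutelyContinuousOnInterval u a b)
    (hd : ∀ᵐ t : ℝ, t ∈ Set.Ioo a b → ∃ u', HasDerivAt u u' t ∧ u' ≤ 0) : u b ≤ u a := by
  have h := hu.integral_deriv_eq_sub
  have h0 : ∫ x in a..b, deriv u x ≤ 0 := by
    rw [intervalIntegral.integral_of_le hab, integral_Ioc_eq_integral_Ioo]
    refine setIntegral_nonpos_ae measurableSet_Ioo ?_
    filter_upwards [hd] with t ht hm
    obtain ⟨u', h1, h2⟩ := ht hm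
    rwa [h1.deriv]
  linarith

/-- Grönwall's inequality for absolutely continuous functions. -/
lemma le_exp_mul_of_ae_hasDerivAt {u : ℝ → ℝ} {a b c : ℝ} (hab : a ≤ b)
    (hu : AbsolutelyContinuousOnInterval u a b)
    (hd : ∀ᵐ t : ℝ, t ∈ Set.Ioo a b → ∃ u', HasDerivAt u u' t ∧ u' ≤ -c * u t) :
    u b ≤ Real.exp (-c * (b - a)) * u a := by
  have hg : LocallyLipschitz fun p : ℝ × ℝ => Real.exp (c * p.1) * p.2 :=
    ContDiff.locallyLipschitz (𝕂 := ℝ) (by fun_prop)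
  have hid : AbsolutelyContinuousOnInterval (fun t : ℝ => t) a b :=
    (LipschitzWith.id.lipschitzOnWith (s := Set.uIcc a b)).absolutelyContinuousOnInterval
  have hp : AbsolutelyContinuousOnInterval (fun t => (t, u t)) a b := by
    refine squeeze_zero (fun E => Finset.sum_nonneg fun i _ => dist_nonneg) (fun E => ?_)
      (by simpa using Filter.Tendsto.add hid hu)
    rw [← Finset.sum_add_distrib]
    refine Finset.sum_le_sum fun i _ => ?_
    rw [Prod.dist_eq]
    exact max_le_add_of_nonneg dist_nonneg dist_nonneg
  have key := le_of_ae_hasDerivAt_nonpos hab (hp.comp_locallyLipschitz hg) (by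
    filter_upwards [hd] with t ht hm
    obtain ⟨u', h1, h2⟩ := ht hm
    refine ⟨_, ((hasDerivAt_id' t).const_mul c).exp.fun_mul h1, ?_⟩
    have := mul_le_mul_of_nonneg_left h2 (Real.exp_pos (c * t)).le
    nlinarith)
  simp only at key
  have h2 : Real.exp (-c * (b - a)) = Real.exp (c * a) * (Real.exp (c * b))⁻¹ := by
    rw [← Real.exp_neg, ← Real.exp_add]; congr 1; ring
  rw [h2, mul_right_comm, ← div_eq_mul_inv, le_div_iff₀ (Real.exp_pos _)]
  linarith

/-! ### Lyapunov functions of hybrid systems with a dwell time -/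

section Lyapunov

variable {E U : Type*} [NormedAddCommGroup E] [NormedSpace ℝ E]

/-- `V` decays at rate at least `c` along any curve whose velocity at a point of the flow set is
given by the flow map. -/
def DecaysAlongFlow (H : HybridSystem E U) (V : E → ℝ) (c : ℝ) : Prop :=
  ∀ (x : ℝ → E) (u : U) (t : ℝ), x t ∈ H.C → HasDerivAt x (H.f (x t) u) t →
    ∃ V', HasDerivAt (fun s => V (x s)) V' t ∧ V' ≤ -c * V (x t)

variable {H : HybridSystem E U} {dom : Set (ℝ × ℕ)} {φ : ℝ → ℕ → E} {m : ℝ → ℕ → U}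

lemma IsSolutionPair.absolutelyContinuous (hs : IsSolutionPair H dom φ m) {j : ℕ} {a b : ℝ}
    (hab : a ≤ b) (hI : Set.Icc a b ⊆ slice dom j) :
    AbsolutelyContinuousOnInterval (fun t => φ t j) a b :=
  hs.arc.2 j a (hI ⟨le_rfl, hab⟩) b (hI ⟨hab, le_rfl⟩)

lemma IsSolutionPair.mem_flowSet (hs : IsSolutionPair H dom φ m) (hC : IsClosed H.C) {j : ℕ}
    {a b : ℝ} (hI : Set.Icc a b ⊆ slice dom j) (ha : φ a j ∈ H.C) {s : ℝ}
    (hsI : s ∈ Set.Icc a b) : φ s j ∈ H.C := by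
  rcases (hsI.1.trans hsI.2).eq_or_lt with h | h
  · rwa [show s = a by linarith [hsI.1, hsI.2]]
  have hmaps : Set.MapsTo (fun t => φ t j) (Set.Ioo a b) H.C := fun t ht =>
    hs.flow_mem j t (interior_mono hI (by rwa [interior_Icc]))
  have hc := (hs.absolutelyContinuous h.le hI).continuousOn
  rw [Set.uIcc_of_le h.le, ← closure_Ioo h.ne] at hc
  rw [← closure_Ioo h.ne] at hsI
  rw [← hC.closure_eq]
  exact hmaps.closure_of_continuousOn hc hsI

lemma IsSolutionPair.le_exp_mul (hs : IsSolutionPair H dom φ m) (hC : IsClosed H.C)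
    {V : E → ℝ} {c : ℝ} (hV : LocallyLipschitz V) (hflow : DecaysAlongFlow H V c) {j : ℕ}
    {a b : ℝ} (hab : a ≤ b) (hI : Set.Icc a b ⊆ slice dom j) (ha : φ a j ∈ H.C) :
    V (φ b j) ≤ Real.exp (-c * (b - a)) * V (φ a j) := by
  refine le_exp_mul_of_ae_hasDerivAt (u := fun s => V (φ s j)) hab
    ((hs.absolutelyContinuous hab hI).comp_locallyLipschitz hV) ?_
  filter_upwards [hs.flow_deriv j] with t ht hm
  exact hflow (fun s => φ s j) (m t j) t
    (hs.mem_flowSet hC hI ha (Set.Ioo_subset_Icc_self hm))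
    (ht (interior_mono hI (by rwa [interior_Icc])))

/-- A clock that runs down at unit rate loses at most the elapsed time. -/
lemma IsSolutionPair.clock_le (hs : IsSolutionPair H dom φ m) (hC : IsClosed H.C)
    {τ : E → ℝ} (hτ : LocallyLipschitz τ)
    (hflow : ∀ (x : ℝ → E) (u : U) (t : ℝ), x t ∈ H.C → HasDerivAt x (H.f (x t) u) t →
      HasDerivAt (fun s => τ (x s)) (-1) t) {j : ℕ}
    {a b : ℝ} (hab : a ≤ b) (hI : Set.Icc a b ⊆ slice dom j) (ha : φ a j ∈ H.C) :
    τ (φ a j) ≤ τ (φ b j) + (b - a) := by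
  have hid : AbsolutelyContinuousOnInterval (fun t : ℝ => t) a b :=
    (LipschitzWith.id.lipschitzOnWith (s := Set.uIcc a b)).absolutelyContinuousOnInterval
  have hu := ((hid.fun_add ((hs.absolutelyContinuous hab hI).comp_locallyLipschitz hτ))).fun_neg
  have := le_of_ae_hasDerivAt_nonpos hab hu (by
    filter_upwards [hs.flow_deriv j] with t ht hm
    have h1 := hflow (fun s => φ s j) (m t j) t
      (hs.mem_flowSet hC hI ha (Set.Ioo_subset_Icc_self hm))
      (ht (interior_mono hI (by rwa [interior_Icc])))
    exact ⟨_, ((hasDerivAt_id t).add h1).neg, by simp⟩)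
  linarith

/-- If a clock forces consecutive jumps to be at least `T₁` apart, a function that decays
exponentially along flows and grows by at most `k` at each jump is bounded by an exponentially
decaying term plus the geometric series `k + k e^{-c T₁} + k e^{-2 c T₁} + ⋯`. -/
theorem IsSolutionPair.lyapunov_bound (hs : IsSolutionPair H dom φ m) (hC : IsClosed H.C)
    (hDC : H.D ⊆ H.C) (hGC : ∀ x ∈ H.D, ∀ u, H.G x u ⊆ H.C)
    {τ V : E → ℝ} {T₁ c k : ℝ} (hT₁ : 0 < T₁) (hc : 0 < c) (hk : 0 ≤ k)
    (hV : LocallyLipschitz V) (hflow : DecaysAlongFlow H V c)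
    (hτ : LocallyLipschitz τ)
    (hτflow : ∀ (x : ℝ → E) (u : U) (t : ℝ), x t ∈ H.C → HasDerivAt x (H.f (x t) u) t →
      HasDerivAt (fun s => τ (x s)) (-1) t)
    (hτD : ∀ x ∈ H.D, τ x = 0) (hτG : ∀ x ∈ H.D, ∀ u, ∀ g ∈ H.G x u, T₁ ≤ τ g)
    (hjump : ∀ t j, (t, j) ∈ dom → (t, j + 1) ∈ dom → V (φ t (j + 1)) ≤ V (φ t j) + k)
    {t : ℝ} {j : ℕ} (htj : (t, j) ∈ dom) :
    φ t j ∈ H.C ∧ (j : ℝ) * T₁ ≤ t + T₁ ∧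
      V (φ t j) ≤ Real.exp (-c * t) * V (φ 0 0) + k / (1 - Real.exp (-c * T₁)) := by
  set q := Real.exp (-c * T₁) with hq
  have hq1 : q < 1 := by rw [hq, Real.exp_lt_one_iff]; nlinarith
  set K := k / (1 - q) with hK
  have hK0 : 0 ≤ K := div_nonneg hk (by linarith)
  have hKk : K * q + k = K := by rw [hK]; field_simp [(sub_pos.2 hq1).ne']; ring
  have hkK : k ≤ K := by have := mul_nonneg hK0 (Real.exp_pos (-c * T₁)).le; linarith
  obtain ⟨s, hs0, hmono, hdom⟩ := hs.arc.1.2 t j htj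
  have hmem : ∀ i ≤ j, Set.Icc (s i) (s (i + 1)) ⊆ slice dom i := fun i hi r hr => by
    have : (r, i) ∈ {p : ℝ × ℕ | p.2 ≤ j ∧ s p.2 ≤ p.1 ∧ p.1 ≤ s (p.2 + 1)} := ⟨hi, hr.1, hr.2⟩
    rw [← hdom] at this
    exact this.1
  have ht : t ∈ Set.Icc (s j) (s (j + 1)) := by
    have : (t, j) ∈ dom ∩ {p : ℝ × ℕ | 0 ≤ p.1 ∧ p.1 ≤ t ∧ p.2 ≤ j} :=
      ⟨htj, hs.arc.1.1 _ htj, le_rfl, le_rfl⟩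
    rw [hdom] at this
    exact this.2
  have hexp : ∀ a b : ℝ, Real.exp (-c * (b - a)) * Real.exp (-c * a) = Real.exp (-c * b) := by
    intro a b; rw [← Real.exp_add]; congr 1; ring
  -- the state right after the `i`-th jump; the term `K` is absent before the first jump
  have key : ∀ i ≤ j, φ (s i) i ∈ H.C ∧ (i = 0 ∨ (T₁ ≤ τ (φ (s i) i) ∧ (i : ℝ) * T₁ ≤ s i + T₁ ∧
      V (φ (s i) i) ≤ Real.exp (-c * s i) * V (φ 0 0) + K)) := by
    intro i
    induction i with
    | zero =>
      intro _
      rw [hs0]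
      refine ⟨?_, Or.inl rfl⟩
      have := hs.init
      rw [hC.closure_eq] at this
      exact this.elim id fun h => hDC h
    | succ i ih =>
      intro hi
      obtain ⟨hCi, ih⟩ := ih (by omega)
      have hi' : i ≤ j := by omega
      have hl := hmono i hi'
      have h1 := hmem i hi' ⟨hl, le_rfl⟩
      have h2 := hmem (i + 1) hi ⟨le_rfl, hmono (i + 1) hi⟩
      obtain ⟨hD, hG⟩ := hs.jump _ _ h1 h2
      refine ⟨hGC _ hD _ hG, Or.inr ⟨hτG _ hD _ _ hG, ?_⟩⟩
      have hVj := hjump _ _ h1 h2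
      have hVf := hs.le_exp_mul hC hV hflow hl (hmem i hi') hCi
      have hτf := hs.clock_le hC hτ hτflow hl (hmem i hi') hCi
      rw [hτD _ hD] at hτf
      rcases ih with rfl | ⟨h3, h4, h5⟩
      · simp only [hs0] at *
        refine ⟨by push_cast; linarith, ?_⟩
        rw [sub_zero] at hVf
        linarith
      · have hdw : T₁ ≤ s (i + 1) - s i := by linarith
        refine ⟨by push_cast; linarith, ?_⟩
        have h6 := mul_le_mul_of_nonneg_left h5 (Real.exp_pos (-c * (s (i + 1) - s i))).le
        rw [mul_add, ← mul_assoc, hexp] at h6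
        have h7 : Real.exp (-c * (s (i + 1) - s i)) ≤ q :=
          Real.exp_le_exp.2 (by nlinarith)
        have h8 := mul_le_mul_of_nonneg_right h7 hK0
        linarith
  obtain ⟨hCj, hj⟩ := key j le_rfl
  have hI : Set.Icc (s j) t ⊆ slice dom j :=
    (Set.Icc_subset_Icc_right ht.2).trans (hmem j le_rfl)
  have hVf := hs.le_exp_mul hC hV hflow ht.1 hI hCj
  refine ⟨hs.mem_flowSet hC hI hCj ⟨ht.1, le_rfl⟩, ?_⟩
  rcases hj with rfl | ⟨-, h4, h5⟩
  · simp only [hs0, sub_zero] at *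
    exact ⟨by push_cast; linarith [ht.1], by linarith⟩
  · refine ⟨by linarith [ht.1], ?_⟩
    have h6 := mul_le_mul_of_nonneg_left h5 (Real.exp_pos (-c * (t - s j))).le
    rw [mul_add, ← mul_assoc, hexp] at h6
    have h7 : Real.exp (-c * (t - s j)) ≤ 1 := Real.exp_le_one_iff.2 (by nlinarith [ht.1])
    have h8 := mul_le_mul_of_nonneg_right h7 hK0
    linarith

end Lyapunov

/-! ### Quadratic forms -/

section QuadForm

variable {ι T : Type*} [Fintype ι]

open Matrix

/-- The quadratic form `x ↦ xᵀ M x`. -/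
def quadForm (M : Matrix ι ι ℝ) (x : ι → ℝ) : ℝ := x ⬝ᵥ M *ᵥ x

lemma dotProduct_self_nonneg_real (x : ι → ℝ) : 0 ≤ x ⬝ᵥ x :=
  Finset.sum_nonneg fun i _ => mul_self_nonneg (x i)

lemma quadForm_smul (M : Matrix ι ι ℝ) (r : ℝ) (x : ι → ℝ) :
    quadForm M (r • x) = r ^ 2 * quadForm M x := by
  simp only [quadForm, mulVec_smul, dotProduct_smul, smul_dotProduct, smul_eq_mul]; ring

lemma quadForm_nonneg {M : Matrix ι ι ℝ} (hM : M.PosSemidef) (x : ι → ℝ) : 0 ≤ quadForm M x := by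
  simpa [quadForm] using hM.dotProduct_mulVec_nonneg x

lemma quadForm_pos {M : Matrix ι ι ℝ} (hM : M.PosDef) {x : ι → ℝ} (hx : x ≠ 0) :
    0 < quadForm M x := by
  simpa [quadForm] using hM.dotProduct_mulVec_pos hx

lemma quadForm_eq_sum (M : Matrix ι ι ℝ) (x : ι → ℝ) :
    quadForm M x = ∑ i, ∑ j, x i * (M i j * x j) := by
  simp only [quadForm, dotProduct, mulVec, Finset.mul_sum]

/-- Young's inequality for the bilinear form of a positive semidefinite matrix. -/
lemma cross_le {M : Matrix ι ι ℝ} (hM : M.PosSemidef) {θ : ℝ} (hθ : 0 < θ) (x y : ι → ℝ) :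
    x ⬝ᵥ M *ᵥ y + y ⬝ᵥ M *ᵥ x ≤ θ * quadForm M x + θ⁻¹ * quadForm M y := by
  have h := quadForm_nonneg hM (θ • x - y)
  have h2 : quadForm M (θ • x - y) =
      θ * (θ * quadForm M x + θ⁻¹ * quadForm M y - (x ⬝ᵥ M *ᵥ y + y ⬝ᵥ M *ᵥ x)) := by
    simp only [quadForm, mulVec_smul, dotProduct_smul, smul_dotProduct, smul_eq_mul, mulVec_sub,
      sub_dotProduct, dotProduct_sub]
    field_simp
    ring
  rw [h2] at h
  linarith [nonneg_of_mul_nonneg_right h hθ]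

lemma quadForm_sub_le {M : Matrix ι ι ℝ} (hM : M.PosSemidef) {θ : ℝ} (hθ : 0 < θ) (x y : ι → ℝ) :
    quadForm M (x - y) ≤ (1 + θ) * quadForm M x + (1 + θ⁻¹) * quadForm M y := by
  have h := cross_le hM hθ (-x) y
  have h2 : quadForm M (x - y) =
      quadForm M x + quadForm M y + (-x ⬝ᵥ M *ᵥ y + y ⬝ᵥ M *ᵥ -x) := by
    simp only [quadForm, mulVec_sub, sub_dotProduct, dotProduct_sub, mulVec_neg, neg_dotProduct,
      dotProduct_neg]
    ring
  have h3 : quadForm M (-x) = quadForm M x := by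
    simp [quadForm, mulVec_neg, neg_dotProduct, dotProduct_neg]
  rw [h3] at h
  linarith

lemma isCompact_unit_dotProduct : IsCompact {x : ι → ℝ | x ⬝ᵥ x = 1} := by
  refine (isCompact_closedBall (0 : ι → ℝ) 1).of_isClosed_subset
    (isClosed_eq (by fun_prop) continuous_const) fun x hx => ?_
  rw [mem_closedBall_zero_iff, pi_norm_le_iff_of_nonneg zero_le_one]
  intro i
  rw [Real.norm_eq_abs, ← sq_le_one_iff_abs_le_one, ← (show x ⬝ᵥ x = 1 from hx), pow_two]
  exact Finset.single_le_sum (f := fun i => x i * x i) (fun j _ => mul_self_nonneg (x j))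
    (Finset.mem_univ i)

lemma exists_unit_smul (x : ι → ℝ) (hx : x ≠ 0) :
    ∃ y : ι → ℝ, ∃ r : ℝ, y ⬝ᵥ y = 1 ∧ x = r • y ∧ r ^ 2 = x ⬝ᵥ x := by
  have h : 0 < x ⬝ᵥ x := (dotProduct_self_nonneg_real x).lt_of_ne fun h => hx
    (dotProduct_self_eq_zero.1 h.symm)
  have h2 : √(x ⬝ᵥ x) ≠ 0 := (Real.sqrt_pos.2 h).ne'
  refine ⟨(√(x ⬝ᵥ x))⁻¹ • x, √(x ⬝ᵥ x), ?_, ?_, Real.sq_sqrt h.le⟩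
  · simp only [dotProduct_smul, smul_dotProduct, smul_eq_mul]
    rw [← mul_assoc, ← mul_inv, Real.mul_self_sqrt h.le, inv_mul_cancel₀ h.ne']
  · rw [smul_smul, mul_inv_cancel₀ h2, one_smul]

lemma continuousOn_quadForm [TopologicalSpace T] {K : Set T} {M : T → Matrix ι ι ℝ}
    (hM : ContinuousOn M K) (s : Set (ι → ℝ)) :
    ContinuousOn (fun p : T × (ι → ℝ) => quadForm (M p.1) p.2) (K ×ˢ s) := by
  have h : Continuous fun p : Matrix ι ι ℝ × (ι → ℝ) => quadForm p.1 p.2 := by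
    unfold quadForm
    fun_prop
  exact h.comp_continuousOn ((hM.comp continuousOn_fst fun p hp => hp.1).prodMk continuousOn_snd)

/-- A continuous family of positive definite matrices over a compact set is uniformly positive
definite. -/
lemma exists_pos_le_quadForm [TopologicalSpace T] {K : Set T} (hK : IsCompact K)
    {M : T → Matrix ι ι ℝ} (hM : ContinuousOn M K) (hpos : ∀ t ∈ K, (M t).PosDef) :
    ∃ δ : ℝ, 0 < δ ∧ ∀ t ∈ K, ∀ x, δ * (x ⬝ᵥ x) ≤ quadForm (M t) x := by
  obtain ⟨δ, hδ, h⟩ := (hK.prod isCompact_unit_dotProduct).exists_forall_le' (a := 0)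
    (continuousOn_quadForm hM _) (by
      rintro ⟨t, x⟩ ⟨ht, hx⟩
      refine quadForm_pos (hpos t ht) ?_
      rintro rfl
      simp at hx)
  refine ⟨δ, hδ, fun t ht x => ?_⟩
  by_cases hx : x = 0
  · simp [hx, quadForm]
  obtain ⟨y, r, hy, rfl, hr⟩ := exists_unit_smul x hx
  rw [← hr, quadForm_smul, mul_comm]
  exact mul_le_mul_of_nonneg_left (h (t, y) ⟨ht, hy⟩) (sq_nonneg r)

/-- A continuous family of matrices over a compact set has uniformly bounded quadratic forms. -/
lemma exists_quadForm_le [TopologicalSpace T] {K : Set T} (hK : IsCompact K)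
    {M : T → Matrix ι ι ℝ} (hM : ContinuousOn M K) :
    ∃ C : ℝ, 0 < C ∧ ∀ t ∈ K, ∀ x, quadForm (M t) x ≤ C * (x ⬝ᵥ x) := by
  obtain ⟨C, h⟩ := ((hK.prod isCompact_unit_dotProduct).image_of_continuousOn
    (continuousOn_quadForm hM _)).bddAbove
  refine ⟨max C 1, by positivity, fun t ht x => ?_⟩
  by_cases hx : x = 0
  · simp [hx, quadForm]
  obtain ⟨y, r, hy, rfl, hr⟩ := exists_unit_smul x hx
  rw [← hr, quadForm_smul, mul_comm]
  refine mul_le_mul_of_nonneg_right (le_trans ?_ (le_max_left C 1)) (sq_nonneg r)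
  exact h ⟨(t, y), ⟨ht, hy⟩, rfl⟩

lemma exists_quadForm_le_const (M : Matrix ι ι ℝ) :
    ∃ C : ℝ, 0 < C ∧ ∀ x, quadForm M x ≤ C * (x ⬝ᵥ x) := by
  obtain ⟨C, hC, h⟩ := exists_quadForm_le (isCompact_singleton (x := (0 : ℝ)))
    (continuousOn_const (c := M))
  exact ⟨C, hC, h 0 rfl⟩

lemma exists_pos_le_quadForm_const {M : Matrix ι ι ℝ} (hM : M.PosDef) :
    ∃ δ : ℝ, 0 < δ ∧ ∀ x, δ * (x ⬝ᵥ x) ≤ quadForm M x := by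
  obtain ⟨C, hC, h⟩ := exists_pos_le_quadForm (isCompact_singleton (x := (0 : ℝ)))
    (continuousOn_const (c := M)) fun _ _ => hM
  exact ⟨C, hC, h 0 rfl⟩

lemma exists_mulVec_dotProduct_self_le {κ : Type*} [Fintype κ] (M : Matrix κ ι ℝ) :
    ∃ C : ℝ, 0 < C ∧ ∀ x, M *ᵥ x ⬝ᵥ M *ᵥ x ≤ C * (x ⬝ᵥ x) := by
  obtain ⟨C, hC, h⟩ := exists_quadForm_le_const (Mᵀ * M)
  refine ⟨C, hC, fun x => le_of_eq_of_le ?_ (h x)⟩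
  rw [quadForm, ← mulVec_mulVec, dotProduct_mulVec x, vecMul_transpose]

lemma hasDerivAt_quadForm {M : ℝ → Matrix ι ι ℝ} {M' : Matrix ι ι ℝ} {x : ℝ → ι → ℝ} {x' : ι → ℝ}
    {t : ℝ} (hM : ∀ i j, HasDerivAt (fun s => M s i j) (M' i j) t)
    (hx : ∀ i, HasDerivAt (fun s => x s i) (x' i) t) :
    HasDerivAt (fun s => quadForm (M s) (x s))
      (x' ⬝ᵥ M t *ᵥ x t + quadForm M' (x t) + x t ⬝ᵥ M t *ᵥ x') t := by
  simp only [quadForm_eq_sum]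
  refine (HasDerivAt.fun_sum fun i _ => HasDerivAt.fun_sum fun j _ =>
    (hx i).fun_mul ((hM i j).fun_mul (hx j))).congr_deriv ?_
  simp only [dotProduct, mulVec, Finset.mul_sum, ← Finset.sum_add_distrib]
  refine Finset.sum_congr rfl fun i _ => Finset.sum_congr rfl fun j _ => ?_
  ring

end QuadForm

/-! ### The Gram matrix of the flow -/

section FlowGram

open Matrix

variable {d : ℕ} (h : ℝ) (P₁ : Matrix (Idx2 d) (Idx2 d) ℝ)

open scoped Matrix.Norms.Operator in
lemma hasDerivAt_flowGram (ν : ℝ) :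
    HasDerivAt (flowGram h P₁)
      ((Af₂ d h)ᵀ * flowGram h P₁ ν + flowGram h P₁ ν * Af₂ d h) ν := by
  refine (((hasDerivAt_exp_smul_const' (𝕂 := ℝ) (Af₂ d h)ᵀ ν).mul_const P₁).mul
    (hasDerivAt_exp_smul_const (𝕂 := ℝ) (Af₂ d h) ν)).congr_deriv ?_
  simp only [flowGram, Matrix.mul_assoc]
  rfl

lemma continuous_flowGram : Continuous (flowGram h P₁) :=
  open scoped Matrix.Norms.Operator in
  continuous_iff_continuousAt.2 fun ν => (hasDerivAt_flowGram h P₁ ν).continuousAt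

lemma hasDerivAt_flowGram_apply (ν : ℝ) (i j : Idx2 d) :
    HasDerivAt (fun s => flowGram h P₁ s i j)
      (((Af₂ d h)ᵀ * flowGram h P₁ ν + flowGram h P₁ ν * Af₂ d h) i j) ν := by
  open scoped Matrix.Norms.Operator in
  exact ((Matrix.entryLinearMap ℝ ℝ i j).toContinuousLinearMap.hasFDerivAt).comp_hasDerivAt ν
    (hasDerivAt_flowGram h P₁ ν)

lemma contDiff_flowGram_apply (i j : Idx2 d) : ContDiff ℝ 1 fun s => flowGram h P₁ s i j := by
  rw [contDiff_one_iff_deriv]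
  refine ⟨fun ν => (hasDerivAt_flowGram_apply h P₁ ν i j).differentiableAt, ?_⟩
  rw [funext fun ν => (hasDerivAt_flowGram_apply h P₁ ν i j).deriv]
  have := continuous_flowGram h P₁
  exact Continuous.matrix_elem (by fun_prop) i j

lemma flowGram_zero : flowGram h P₁ 0 = P₁ := by simp [flowGram]

variable {P₁} in
lemma posDef_flowGram (hP₁ : P₁.PosDef) (ν : ℝ) : (flowGram h P₁ ν).PosDef := by
  rw [flowGram, ← transpose_smul, exp_transpose, ← conjTranspose_eq_transpose_of_trivial]
  exact hP₁.conjTranspose_mul_mul_same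
    (Matrix.mulVec_injective_of_isUnit (Matrix.isUnit_exp _))

end FlowGram

/-! ### The Lyapunov function -/

section LyapunovFunction

open Matrix State

variable {d : ℕ}

/-- Squared Euclidean norm of the components of the state that vanish on the synchronization set. -/
def syncErrSq (χ : State d) : ℝ :=
  χ.z₁ 1 ^ 2 + χ.z₂ ⬝ᵥ χ.z₂ + χ.w₁ ⬝ᵥ χ.w₁ + χ.w₂ ⬝ᵥ χ.w₂

/-- The Lyapunov function. The weights `e^{aτ}` and `e^{στ}` decrease along flows, which turns the
decrease of the first two terms at jumps into an exponential decrease in ordinary time. -/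
noncomputable def lyap (h a σ κ : ℝ) (P₁ : Matrix (Idx2 d) (Idx2 d) ℝ)
    (P₂ : Matrix (Fin 2) (Fin 2) ℝ) (P₃ : Matrix (Idx2 d) (Idx2 d) ℝ) (χ : State d) : ℝ :=
  Real.exp (a * χ.τ) * χ.z₁ 1 ^ 2 + Real.exp (σ * χ.τ) * quadForm (flowGram h P₁ χ.τ) χ.z₂ +
    κ * (quadForm P₂ χ.w₁ + quadForm P₃ χ.w₂)

lemma contDiff_lyap (h a σ κ : ℝ) (P₁ : Matrix (Idx2 d) (Idx2 d) ℝ)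
    (P₂ : Matrix (Fin 2) (Fin 2) ℝ) (P₃ : Matrix (Idx2 d) (Idx2 d) ℝ) :
    ContDiff ℝ 1 (lyap h a σ κ P₁ P₂ P₃) := by
  have hQ : ∀ i j, ContDiff ℝ 1 fun χ : State d => flowGram h P₁ χ.τ i j := fun i j =>
    (contDiff_flowGram_apply h P₁ i j).comp (by unfold State.τ; fun_prop)
  unfold lyap
  simp only [quadForm_eq_sum]
  unfold State.z₁ State.z₂ State.w₁ State.w₂
  unfold State.τ at *
  fun_prop

lemma hasDerivAt_apply {x : ℝ → State d} {x' : State d} {t : ℝ} (hx : HasDerivAt x x' t)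
    (i : StateIdx d) : HasDerivAt (fun s => x s i) (x' i) t :=
  (EuclideanSpace.proj (𝕜 := ℝ) i).hasFDerivAt.comp_hasDerivAt t hx

/-- Derivative of `zᵀ Q(τ) z` when `ż = A z + b`, `Q' = Aᵀ Q + Q A` and `τ̇ = -1`: only the forcing `b`
contributes. -/
lemma flow_cross_eq {ι : Type*} [Fintype ι] (A Q : Matrix ι ι ℝ) (z b : ι → ℝ) :
    (A *ᵥ z + b) ⬝ᵥ Q *ᵥ z + quadForm (-(Aᵀ * Q + Q * A)) z + z ⬝ᵥ Q *ᵥ (A *ᵥ z + b) =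
      z ⬝ᵥ Q *ᵥ b + b ⬝ᵥ Q *ᵥ z := by
  have h : z ⬝ᵥ Aᵀ *ᵥ Q *ᵥ z = A *ᵥ z ⬝ᵥ Q *ᵥ z := by
    rw [dotProduct_mulVec z Aᵀ, vecMul_transpose]
  simp only [quadForm, neg_mulVec, add_mulVec, ← mulVec_mulVec, mulVec_add, dotProduct_add,
    add_dotProduct, dotProduct_neg, h]
  ring

lemma lyapunov_inequality {ι : Type*} [Fintype ι] [DecidableEq ι] {A P : Matrix ι ι ℝ} {β : ℝ}
    (h : (-(β • (1 : Matrix ι ι ℝ)) - (P * A + Aᵀ * P)).PosSemidef) (w : ι → ℝ) :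
    A *ᵥ w ⬝ᵥ P *ᵥ w + quadForm 0 w + w ⬝ᵥ P *ᵥ A *ᵥ w ≤ -β * (w ⬝ᵥ w) := by
  have h1 := quadForm_nonneg h w
  have h2 : w ⬝ᵥ Aᵀ *ᵥ P *ᵥ w = A *ᵥ w ⬝ᵥ P *ᵥ w := by
    rw [dotProduct_mulVec w Aᵀ, vecMul_transpose]
  simp only [quadForm, sub_mulVec, neg_mulVec, add_mulVec, ← mulVec_mulVec, dotProduct_sub, h2,
    dotProduct_neg, dotProduct_add, smul_mulVec, one_mulVec, dotProduct_smul, smul_eq_mul,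
    zero_mulVec, dotProduct_zero] at h1 ⊢
  linarith

variable {T₁ T₂ μ h γ : ℝ} {Lb : Matrix (Fin d) (Fin d) ℝ}
  {P₁ : Matrix (Idx2 d) (Idx2 d) ℝ} {P₂ : Matrix (Fin 2) (Fin 2) ℝ}
  {P₃ : Matrix (Idx2 d) (Idx2 d) ℝ}

lemma hasDerivAt_timer {x : ℝ → State d} {u : Noise d} {t : ℝ}
    (hx : HasDerivAt x ((noisySystem T₁ T₂ μ h γ Lb).f (x t) u) t) :
    HasDerivAt (fun s => (x s).τ) (-1) t :=
  hasDerivAt_apply hx _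

lemma lyap_flow {a σ κ β₁ β₂ : ℝ} (ha : 2 * h + 1 ≤ a) (hσ : 0 < σ) (hκ : 0 ≤ κ)
    (hP₁ : P₁.PosDef)
    (hlyap₂ : (-(β₁ • (1 : Matrix (Fin 2) (Fin 2) ℝ)) -
      (P₂ * Af₃ μ + (Af₃ μ).transpose * P₂)).PosSemidef)
    (hlyap₃ : (-(β₂ • (1 : Matrix (Idx2 d) (Idx2 d) ℝ)) -
      (P₃ * Af₄ d μ + (Af₄ d μ).transpose * P₃)).PosSemidef)
    {x : ℝ → State d} {u : Noise d} {t : ℝ}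
    (hx : HasDerivAt x ((noisySystem T₁ T₂ μ h γ Lb).f (x t) u) t) :
    ∃ V', HasDerivAt (fun s => lyap h a σ κ P₁ P₂ P₃ (x s)) V' t ∧
      V' ≤ -(Real.exp (a * (x t).τ) * (x t).z₁ 1 ^ 2)
        - σ / 2 * (Real.exp (σ * (x t).τ) * quadForm (flowGram h P₁ (x t).τ) (x t).z₂)
        + Real.exp (σ * (x t).τ) *
          (2 / σ * quadForm (flowGram h P₁ (x t).τ) (Bf₂ d *ᵥ (x t).w₂))
        - κ * (β₁ * ((x t).w₁ ⬝ᵥ (x t).w₁) + β₂ * ((x t).w₂ ⬝ᵥ (x t).w₂)) := by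
  have hτ := hasDerivAt_timer hx
  have hη : HasDerivAt (fun s => (x s).z₁ 1) (h * (x t).z₁ 1) t :=
    (hasDerivAt_apply hx (Sum.inl 1)).congr_deriv (by
      simp [noisySystem, State.mk, Af₁, Bf₁, dotProduct, Fin.sum_univ_two])
  have hz : ∀ i, HasDerivAt (fun s => (x s).z₂ i) ((Af₂ d h *ᵥ (x t).z₂ + Bf₂ d *ᵥ (x t).w₂) i) t :=
    fun i => hasDerivAt_apply hx (Sum.inr (Sum.inl i))
  have hw₁ : ∀ i, HasDerivAt (fun s => (x s).w₁ i) ((Af₃ μ *ᵥ (x t).w₁) i) t :=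
    fun i => hasDerivAt_apply hx (Sum.inr (Sum.inr (Sum.inl i)))
  have hw₂ : ∀ i, HasDerivAt (fun s => (x s).w₂ i) ((Af₄ d μ *ᵥ (x t).w₂) i) t :=
    fun i => hasDerivAt_apply hx (Sum.inr (Sum.inr (Sum.inr (Sum.inl i))))
  have hQ : ∀ i j, HasDerivAt (fun s => flowGram h P₁ (x s).τ i j)
      ((-((Af₂ d h)ᵀ * flowGram h P₁ (x t).τ + flowGram h P₁ (x t).τ * Af₂ d h)) i j) t :=
    fun i j => (HasDerivAt.comp t (h₂ := fun ν => flowGram h P₁ ν i j)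
      (hasDerivAt_flowGram_apply h P₁ (x t).τ i j) hτ).congr_deriv (by
        rw [mul_neg_one, Matrix.neg_apply])
  have hz₂ := hasDerivAt_quadForm hQ hz
  have hq₁ := hasDerivAt_quadForm (M := fun _ => P₂) (M' := 0)
    (fun i j => hasDerivAt_const t (P₂ i j)) hw₁
  have hq₂ := hasDerivAt_quadForm (M := fun _ => P₃) (M' := 0)
    (fun i j => hasDerivAt_const t (P₃ i j)) hw₂
  refine ⟨_, (((hτ.const_mul a).exp.fun_mul (hη.fun_pow 2)).fun_add
    ((hτ.const_mul σ).exp.fun_mul hz₂)).fun_add ((hq₁.fun_add hq₂).const_mul κ), ?_⟩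
  have h1 := cross_le (posDef_flowGram h hP₁ (x t).τ).posSemidef (half_pos hσ) (x t).z₂
    (Bf₂ d *ᵥ (x t).w₂)
  rw [inv_div] at h1
  rw [flow_cross_eq]
  have h2 := mul_le_mul_of_nonneg_left h1 (Real.exp_pos (σ * (x t).τ)).le
  have h3 := mul_le_mul_of_nonneg_left
    (add_le_add (lyapunov_inequality hlyap₂ (x t).w₁) (lyapunov_inequality hlyap₃ (x t).w₂)) hκ
  have h4 : 0 ≤ Real.exp (a * (x t).τ) * (x t).z₁ 1 ^ 2 := by positivity
  have h5 := mul_nonneg (sub_nonneg.2 ha) h4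
  push_cast
  linarith

lemma lyap_bounds {a σ κ δ₁ δ₂ δ₃ C₁ C₂ C₃ : ℝ} (ha : 0 ≤ a) (hσ : 0 ≤ σ) (hκ : 0 < κ)
    (hδ₁ : 0 < δ₁) (hδ₂ : 0 < δ₂) (hδ₃ : 0 < δ₃) (hC₁ : 0 < C₁) (hC₂ : 0 < C₂) (hC₃ : 0 < C₃)
    (h₁ : ∀ ν ∈ Set.Icc 0 T₂, ∀ z, δ₁ * (z ⬝ᵥ z) ≤ quadForm (flowGram h P₁ ν) z)
    (h₁' : ∀ ν ∈ Set.Icc 0 T₂, ∀ z, quadForm (flowGram h P₁ ν) z ≤ C₁ * (z ⬝ᵥ z))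
    (h₂ : ∀ w, δ₂ * (w ⬝ᵥ w) ≤ quadForm P₂ w) (h₂' : ∀ w, quadForm P₂ w ≤ C₂ * (w ⬝ᵥ w))
    (h₃ : ∀ w, δ₃ * (w ⬝ᵥ w) ≤ quadForm P₃ w) (h₃' : ∀ w, quadForm P₃ w ≤ C₃ * (w ⬝ᵥ w)) :
    ∃ δ C : ℝ, 0 < δ ∧ 0 < C ∧ ∀ χ : State d, χ.τ ∈ Set.Icc 0 T₂ →
      δ * syncErrSq χ ≤ lyap h a σ κ P₁ P₂ P₃ χ ∧ lyap h a σ κ P₁ P₂ P₃ χ ≤ C * syncErrSq χ := by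
  refine ⟨min (min 1 δ₁) (min (κ * δ₂) (κ * δ₃)),
    Real.exp (a * T₂) + Real.exp (σ * T₂) * C₁ + κ * C₂ + κ * C₃, by positivity, by positivity,
    fun χ hχ => ?_⟩
  have hz := dotProduct_self_nonneg_real χ.z₂
  have hw₁ := dotProduct_self_nonneg_real χ.w₁
  have hw₂ := dotProduct_self_nonneg_real χ.w₂
  have hη := sq_nonneg (χ.z₁ 1)
  have hexp : ∀ b : ℝ, 0 ≤ b → 1 ≤ Real.exp (b * χ.τ) ∧ Real.exp (b * χ.τ) ≤ Real.exp (b * T₂) :=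
    fun b hb => ⟨Real.one_le_exp (mul_nonneg hb hχ.1),
      Real.exp_le_exp.2 (mul_le_mul_of_nonneg_left hχ.2 hb)⟩
  obtain ⟨ha1, ha2⟩ := hexp a ha
  obtain ⟨hs1, hs2⟩ := hexp σ hσ
  have hq0 : 0 ≤ quadForm (flowGram h P₁ χ.τ) χ.z₂ :=
    (mul_nonneg hδ₁.le hz).trans (h₁ _ hχ _)
  unfold syncErrSq lyap
  constructor
  · set δ := min (min 1 δ₁) (min (κ * δ₂) (κ * δ₃)) with hδ
    have d1 : δ ≤ 1 := (min_le_left _ _).trans (min_le_left _ _)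
    have d2 : δ ≤ δ₁ := (min_le_left _ _).trans (min_le_right _ _)
    have d3 : δ ≤ κ * δ₂ := (min_le_right _ _).trans (min_le_left _ _)
    have d4 : δ ≤ κ * δ₃ := (min_le_right _ _).trans (min_le_right _ _)
    have e1 := mul_le_mul_of_nonneg_right (d1.trans ha1) hη
    have e2 := (mul_le_mul_of_nonneg_right d2 hz).trans (h₁ _ hχ _)
    have e2' := le_mul_of_one_le_left hq0 hs1
    have e3 := mul_le_mul_of_nonneg_right d3 hw₁
    have e3' := mul_le_mul_of_nonneg_left (h₂ χ.w₁) hκ.le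
    have e4 := mul_le_mul_of_nonneg_right d4 hw₂
    have e4' := mul_le_mul_of_nonneg_left (h₃ χ.w₂) hκ.le
    linarith
  · have e1 := mul_le_mul_of_nonneg_right ha2 hη
    have e2 := mul_le_mul hs2 (h₁' _ hχ χ.z₂) hq0 (Real.exp_pos _).le
    have e3 := mul_le_mul_of_nonneg_left (h₂' χ.w₁) hκ.le
    have e4 := mul_le_mul_of_nonneg_left (h₃' χ.w₂) hκ.le
    have p1 := (Real.exp_pos (a * T₂)).le
    have p2 : 0 ≤ Real.exp (σ * T₂) * C₁ := by positivity
    have p3 : 0 ≤ κ * C₂ := by positivity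
    have p4 : 0 ≤ κ * C₃ := by positivity
    have f1 := mul_nonneg p1 (add_nonneg (add_nonneg hz hw₁) hw₂)
    have f2 := mul_nonneg p2 (add_nonneg (add_nonneg hη hw₁) hw₂)
    have f3 := mul_nonneg p3 (add_nonneg (add_nonneg hη hz) hw₂)
    have f4 := mul_nonneg p4 (add_nonneg (add_nonneg hη hz) hw₁)
    linarith

lemma noiseTerm_dotProduct_self_le (γ : ℝ) (Lb : Matrix (Fin d) (Fin d) ℝ) :
    ∃ C : ℝ, 0 < C ∧ ∀ m : Noise d, noiseTerm γ Lb m ⬝ᵥ noiseTerm γ Lb m ≤ C * ‖m‖ ^ 2 := by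
  obtain ⟨C, hC, hle⟩ := exists_mulVec_dotProduct_self_le (γ • Lb)
  refine ⟨C, hC, fun m => ?_⟩
  have h1 : noiseTerm γ Lb m ⬝ᵥ noiseTerm γ Lb m =
      ((γ • Lb) *ᵥ fun i => m i.succ) ⬝ᵥ ((γ • Lb) *ᵥ fun i => m i.succ) := by
    simp [noiseTerm, dotProduct]
  rw [h1]
  refine (hle _).trans (mul_le_mul_of_nonneg_left ?_ hC.le)
  rw [EuclideanSpace.real_norm_sq_eq, Fin.sum_univ_succ, dotProduct]
  simp only [pow_two]
  linarith [mul_self_nonneg (m 0)]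

/-- The strict matrix inequality on the compact interval `[T₁, T₂]` leaves a margin: it survives
multiplication of the state after the jump by some `s > 1`. -/
lemma exists_jump_margin
    (hjump : ∀ ν ∈ Set.Icc T₁ T₂, (-jumpDiff h γ Lb P₁ ν).PosDef) :
    ∃ s : ℝ, 1 < s ∧ ∀ ν ∈ Set.Icc T₁ T₂, ∀ z,
      s * quadForm (flowGram h P₁ ν) (Ag₂ γ Lb *ᵥ z) ≤ quadForm P₁ z := by
  have hcont := continuous_flowGram h P₁
  obtain ⟨δ, hδ, h1⟩ := exists_pos_le_quadForm (isCompact_Icc (a := T₁) (b := T₂))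
    (M := fun ν => -jumpDiff h γ Lb P₁ ν) (by unfold jumpDiff; fun_prop) hjump
  obtain ⟨C, hC, h2⟩ := exists_quadForm_le (isCompact_Icc (a := T₁) (b := T₂))
    hcont.continuousOn
  obtain ⟨B, hB, h3⟩ := exists_mulVec_dotProduct_self_le (Ag₂ γ Lb)
  refine ⟨1 + δ / (C * B), lt_add_of_pos_right _ (by positivity), fun ν hν z => ?_⟩
  have e1 := h1 ν hν z
  have e2 : quadForm (-jumpDiff h γ Lb P₁ ν) z =
      quadForm P₁ z - quadForm (flowGram h P₁ ν) (Ag₂ γ Lb *ᵥ z) := by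
    simp only [quadForm, jumpDiff, neg_sub, sub_mulVec, dotProduct_sub, ← mulVec_mulVec]
    rw [dotProduct_mulVec z (Ag₂ γ Lb)ᵀ, vecMul_transpose]
  have e3 : quadForm (flowGram h P₁ ν) (Ag₂ γ Lb *ᵥ z) ≤ C * (B * (z ⬝ᵥ z)) :=
    (h2 ν hν _).trans (mul_le_mul_of_nonneg_left (h3 z) hC.le)
  have e4 := mul_le_mul_of_nonneg_left e3 (show 0 ≤ δ / (C * B) by positivity)
  have e5 : δ / (C * B) * (C * (B * (z ⬝ᵥ z))) = δ * (z ⬝ᵥ z) := by field_simp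
  linarith

lemma lyap_jump {a σ κ r C N : ℝ} (hT₁ : 0 < T₁) (hσ : 0 ≤ σ) (hP₁ : P₁.PosDef) (hr : 1 < r)
    (hσr : Real.exp (σ * T₂) = r) (hC : 0 ≤ C)
    (hmargin : ∀ ν ∈ Set.Icc T₁ T₂, ∀ z,
      r ^ 2 * quadForm (flowGram h P₁ ν) (Ag₂ γ Lb *ᵥ z) ≤ quadForm P₁ z)
    (hQ : ∀ ν ∈ Set.Icc 0 T₂, ∀ z, quadForm (flowGram h P₁ ν) z ≤ C * (z ⬝ᵥ z))
    (hN : ∀ m : Noise d, noiseTerm γ Lb m ⬝ᵥ noiseTerm γ Lb m ≤ N * ‖m‖ ^ 2)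
    {χ g : State d} {m : Noise d} (hχ : χ ∈ (noisySystem T₁ T₂ μ h γ Lb).D)
    (hg : g ∈ (noisySystem T₁ T₂ μ h γ Lb).G χ m) :
    lyap h a σ κ P₁ P₂ P₃ g ≤
      lyap h a σ κ P₁ P₂ P₃ χ + r * (1 + (r - 1)⁻¹) * C * N * ‖m‖ ^ 2 := by
  obtain ⟨ν, hν, rfl⟩ := hg
  have hτ : χ.τ = 0 := hχ.2
  have hν0 : ν ∈ Set.Icc 0 T₂ := ⟨hT₁.le.trans hν.1, hν.2⟩
  have h1 : (State.mk (Ag₁ *ᵥ χ.z₁) (Ag₂ γ Lb *ᵥ χ.z₂ - noiseTerm γ Lb m) χ.w₁ χ.w₂ ν).z₁ 1 = 0 := by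
    simp [State.z₁, State.mk, Ag₁, dotProduct, Fin.sum_univ_two]
  have h2 : (State.mk (Ag₁ *ᵥ χ.z₁) (Ag₂ γ Lb *ᵥ χ.z₂ - noiseTerm γ Lb m) χ.w₁ χ.w₂ ν).z₂ =
    Ag₂ γ Lb *ᵥ χ.z₂ - noiseTerm γ Lb m := rfl
  have h3 : (State.mk (Ag₁ *ᵥ χ.z₁) (Ag₂ γ Lb *ᵥ χ.z₂ - noiseTerm γ Lb m) χ.w₁ χ.w₂ ν).w₁ =
    χ.w₁ := rfl
  have h4 : (State.mk (Ag₁ *ᵥ χ.z₁) (Ag₂ γ Lb *ᵥ χ.z₂ - noiseTerm γ Lb m) χ.w₁ χ.w₂ ν).w₂ =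
    χ.w₂ := rfl
  have h5 : (State.mk (Ag₁ *ᵥ χ.z₁) (Ag₂ γ Lb *ᵥ χ.z₂ - noiseTerm γ Lb m) χ.w₁ χ.w₂ ν).τ = ν := rfl
  simp only [lyap, h1, h2, h3, h4, h5, hτ, mul_zero, Real.exp_zero, flowGram_zero]
  have hr' : 0 < r - 1 := by linarith
  have hps := (posDef_flowGram h hP₁ ν).posSemidef
  have e1 := quadForm_sub_le hps hr' (Ag₂ γ Lb *ᵥ χ.z₂) (noiseTerm γ Lb m)
  have e2 : Real.exp (σ * ν) ≤ r := hσr ▸ Real.exp_le_exp.2 (mul_le_mul_of_nonneg_left hν.2 hσ)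
  have e3 := mul_le_mul_of_nonneg_right e2
    (quadForm_nonneg hps (Ag₂ γ Lb *ᵥ χ.z₂ - noiseTerm γ Lb m))
  have e4 := mul_le_mul_of_nonneg_left e1 (zero_le_one.trans hr.le)
  have e5 := hmargin ν hν χ.z₂
  have e6 : quadForm (flowGram h P₁ ν) (noiseTerm γ Lb m) ≤ C * (N * ‖m‖ ^ 2) :=
    (hQ ν hν0 _).trans (mul_le_mul_of_nonneg_left (hN m) hC)
  have e7 := mul_le_mul_of_nonneg_left e6 (show 0 ≤ r * (1 + (r - 1)⁻¹) by positivity)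
  have e8 := sq_nonneg (χ.z₁ 1)
  linarith

/-- A Lyapunov function for the noisy system: it decays exponentially along flows, grows at jumps by
at most a multiple of the squared noise, and is comparable to the squared synchronization error. -/
theorem exists_lyapunov {β₁ β₂ : ℝ} (hT₁ : 0 < T₁) (hT₂ : T₁ ≤ T₂)
    (hP₁ : P₁.PosDef) (hP₂ : P₂.PosDef) (hP₃ : P₃.PosDef) (hβ₁ : 0 < β₁) (hβ₂ : 0 < β₂)
    (hlyap₂ : (-(β₁ • (1 : Matrix (Fin 2) (Fin 2) ℝ)) -
      (P₂ * Af₃ μ + (Af₃ μ).transpose * P₂)).PosSemidef)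
    (hlyap₃ : (-(β₂ • (1 : Matrix (Idx2 d) (Idx2 d) ℝ)) -
      (P₃ * Af₄ d μ + (Af₄ d μ).transpose * P₃)).PosSemidef)
    (hjump : ∀ ν ∈ Set.Icc T₁ T₂, (-jumpDiff h γ Lb P₁ ν).PosDef) :
    ∃ (V : State d → ℝ) (c δ C k : ℝ), 0 < c ∧ 0 < δ ∧ 0 < C ∧ 0 < k ∧ LocallyLipschitz V ∧
      DecaysAlongFlow (noisySystem T₁ T₂ μ h γ Lb) V c ∧
      (∀ χ : State d, χ.τ ∈ Set.Icc 0 T₂ → δ * syncErrSq χ ≤ V χ ∧ V χ ≤ C * syncErrSq χ) ∧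
      ∀ χ ∈ (noisySystem T₁ T₂ μ h γ Lb).D, ∀ m, ∀ g ∈ (noisySystem T₁ T₂ μ h γ Lb).G χ m,
        V g ≤ V χ + k * ‖m‖ ^ 2 := by
  have hT : 0 < T₂ := hT₁.trans_le hT₂
  have hQc := (continuous_flowGram h P₁).continuousOn (s := Set.Icc 0 T₂)
  obtain ⟨δ₁, hδ₁, l₁⟩ := exists_pos_le_quadForm isCompact_Icc hQc
    fun ν _ => posDef_flowGram h hP₁ ν
  obtain ⟨C₁, hC₁, u₁⟩ := exists_quadForm_le isCompact_Icc hQc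
  obtain ⟨δ₂, hδ₂, l₂⟩ := exists_pos_le_quadForm_const hP₂
  obtain ⟨C₂, hC₂, u₂⟩ := exists_quadForm_le_const P₂
  obtain ⟨δ₃, hδ₃, l₃⟩ := exists_pos_le_quadForm_const hP₃
  obtain ⟨C₃, hC₃, u₃⟩ := exists_quadForm_le_const P₃
  obtain ⟨B, hB, hBle⟩ := exists_mulVec_dotProduct_self_le (Bf₂ d)
  obtain ⟨N, hN, hNle⟩ := noiseTerm_dotProduct_self_le γ Lb
  obtain ⟨s, hs, hmargin⟩ := exists_jump_margin hjump
  -- the margin `s = r²` is shared between the weight `e^{σ T₂} = r` and the noise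
  obtain ⟨r, hr, rfl⟩ : ∃ r : ℝ, 1 < r ∧ s = r ^ 2 :=
    ⟨√s, by rwa [Real.lt_sqrt zero_le_one, one_pow], (Real.sq_sqrt (by linarith)).symm⟩
  obtain ⟨σ, hσ, hσr⟩ : ∃ σ : ℝ, 0 < σ ∧ Real.exp (σ * T₂) = r :=
    ⟨Real.log r / T₂, div_pos (Real.log_pos hr) hT, by
      rw [div_mul_cancel₀ _ hT.ne', Real.exp_log (by linarith)]⟩
  obtain ⟨a, ha, ha0⟩ : ∃ a : ℝ, 2 * h + 1 ≤ a ∧ 0 ≤ a :=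
    ⟨2 * |h| + 1, by linarith [le_abs_self h], by positivity⟩
  have hr0 : 0 < r := by linarith
  have hr1 : 0 < r - 1 := by linarith
  -- large enough for the decay of `w₂` to absorb its effect on `z₂`
  obtain ⟨κ, hκ, hκβ⟩ : ∃ κ : ℝ, 0 < κ ∧ r * (2 / σ * (C₁ * B)) = κ * (β₂ / 2) :=
    ⟨r * (2 / σ * (C₁ * B)) / (β₂ / 2), by positivity, by field_simp⟩
  obtain ⟨δ, C, hδ, hC, hb⟩ := lyap_bounds (a := a) (σ := σ) (κ := κ) ha0 hσ.le hκ hδ₁ hδ₂ hδ₃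
    hC₁ hC₂ hC₃ l₁ u₁ l₂ u₂ l₃ u₃
  set c := min (min 1 (σ / 2)) (min (β₁ / C₂) (β₂ / 2 / C₃)) with hc
  have c1 : c ≤ 1 := (min_le_left _ _).trans (min_le_left _ _)
  have c2 : c ≤ σ / 2 := (min_le_left _ _).trans (min_le_right _ _)
  have c3 : c * C₂ ≤ β₁ := (le_div_iff₀ hC₂).1 ((min_le_right _ _).trans (min_le_left _ _))
  have c4 : c * C₃ ≤ β₂ / 2 := (le_div_iff₀ hC₃).1 ((min_le_right _ _).trans (min_le_right _ _))
  have hc0 : 0 < c := by positivity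
  refine ⟨lyap h a σ κ P₁ P₂ P₃, c, δ, C, r * (1 + (r - 1)⁻¹) * C₁ * N, hc0, hδ, hC,
    by positivity, (contDiff_lyap h a σ κ P₁ P₂ P₃).locallyLipschitz, ?_, hb, ?_⟩
  · intro x u t hxC hx
    obtain ⟨V', hV', hle⟩ := lyap_flow (a := a) ha hσ hκ.le hP₁ hlyap₂ hlyap₃ hx
    refine ⟨V', hV', hle.trans ?_⟩
    replace hxC : (x t).τ ∈ Set.Icc 0 T₂ := hxC
    generalize x t = χ at hxC
    have hw₁ := dotProduct_self_nonneg_real χ.w₁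
    have hw₂ := dotProduct_self_nonneg_real χ.w₂
    have hq₁ : 0 ≤ Real.exp (σ * χ.τ) * quadForm (flowGram h P₁ χ.τ) χ.z₂ :=
      mul_nonneg (Real.exp_pos _).le (quadForm_nonneg (posDef_flowGram h hP₁ _).posSemidef _)
    have e1 := mul_le_mul_of_nonneg_right c1
      (mul_nonneg (Real.exp_pos (a * χ.τ)).le (sq_nonneg (χ.z₁ 1)))
    have e2 := mul_le_mul_of_nonneg_right c2 hq₁
    have e3 : quadForm (flowGram h P₁ χ.τ) (Bf₂ d *ᵥ χ.w₂) ≤ C₁ * (B * (χ.w₂ ⬝ᵥ χ.w₂)) :=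
      (u₁ _ hxC _).trans (mul_le_mul_of_nonneg_left (hBle _) hC₁.le)
    have e4 : Real.exp (σ * χ.τ) ≤ r :=
      hσr ▸ Real.exp_le_exp.2 (mul_le_mul_of_nonneg_left hxC.2 hσ.le)
    have e5 : Real.exp (σ * χ.τ) * (2 / σ * quadForm (flowGram h P₁ χ.τ) (Bf₂ d *ᵥ χ.w₂)) ≤
        r * (2 / σ * (C₁ * (B * (χ.w₂ ⬝ᵥ χ.w₂)))) :=
      mul_le_mul e4 (mul_le_mul_of_nonneg_left e3 (by positivity))
        (mul_nonneg (by positivity) (quadForm_nonneg (posDef_flowGram h hP₁ _).posSemidef _)) hr0.le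
    have e6 : r * (2 / σ * (C₁ * (B * (χ.w₂ ⬝ᵥ χ.w₂)))) = κ * (β₂ / 2) * (χ.w₂ ⬝ᵥ χ.w₂) := by
      rw [← hκβ]; ring
    have e7 := mul_le_mul_of_nonneg_left
      (add_le_add ((mul_le_mul_of_nonneg_left (u₂ χ.w₁) hc0.le).trans
        (le_of_eq_of_le (mul_assoc _ _ _).symm (mul_le_mul_of_nonneg_right c3 hw₁)))
      ((mul_le_mul_of_nonneg_left (u₃ χ.w₂) hc0.le).trans
        (le_of_eq_of_le (mul_assoc _ _ _).symm (mul_le_mul_of_nonneg_right c4 hw₂)))) hκ.le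
    unfold lyap
    linarith
  · intro χ hχ m g hg
    exact lyap_jump hT₁ hσ.le hP₁ hr hσr hC₁.le hmargin u₁ hNle hχ hg

end LyapunovFunction

/-! ### Distance to the synchronization set -/

section Distance

open Matrix State

variable {d : ℕ}

lemma dist_sq_eq (χ ψ : State d) :
    dist χ ψ ^ 2 = (χ.z₁ 0 - ψ.z₁ 0) ^ 2 + (χ.z₁ 1 - ψ.z₁ 1) ^ 2 +
      (χ.z₂ - ψ.z₂) ⬝ᵥ (χ.z₂ - ψ.z₂) + (χ.w₁ - ψ.w₁) ⬝ᵥ (χ.w₁ - ψ.w₁) +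
      (χ.w₂ - ψ.w₂) ⬝ᵥ (χ.w₂ - ψ.w₂) + (χ.τ - ψ.τ) ^ 2 := by
  rw [EuclideanSpace.dist_sq_eq]
  simp only [Fintype.sum_sum_type, Real.dist_eq, sq_abs, Fin.sum_univ_two, dotProduct, Pi.sub_apply,
    State.z₁, State.z₂, State.w₁, State.w₂, State.τ, Finset.univ_unique, Finset.sum_singleton,
    PUnit.default_eq_unit, ← pow_two]
  ring

lemma infDist_syncSet_sq {T₂ : ℝ} {χ : State d} (hχ : χ.τ ∈ Set.Icc 0 T₂) :
    Metric.infDist χ (syncSet d T₂) ^ 2 = syncErrSq χ := by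
  -- the point of the synchronization set that shares the free coordinates with `χ`
  set p : State d := State.mk ![χ.z₁ 0, 0] 0 0 0 χ.τ with hp
  have hpA : p ∈ syncSet d T₂ := ⟨hχ, ⟨χ.z₁ 0, rfl⟩, rfl, rfl, rfl⟩
  have hdist : dist χ p ^ 2 = syncErrSq χ := by
    rw [dist_sq_eq, show p.z₁ = ![χ.z₁ 0, 0] from rfl, show p.z₂ = 0 from rfl,
      show p.w₁ = 0 from rfl, show p.w₂ = 0 from rfl, show p.τ = χ.τ from rfl]
    simp [syncErrSq]
  refine le_antisymm ?_ ?_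
  · rw [← hdist]
    exact pow_le_pow_left₀ Metric.infDist_nonneg (Metric.infDist_le_dist_of_mem hpA) 2
  · rw [← Real.sqrt_le_left Metric.infDist_nonneg]
    refine (Metric.le_infDist ⟨p, hpA⟩).2 fun ψ hψ => ?_
    obtain ⟨-, ⟨e, he⟩, h2, h3, h4⟩ := hψ
    rw [Real.sqrt_le_left dist_nonneg, dist_sq_eq, he, h2, h3, h4]
    simp only [syncErrSq, sub_zero, cons_val_one, cons_val_fin_one]
    linarith [sq_nonneg (χ.z₁ 0 - ![e, 0] 0), sq_nonneg (χ.τ - ψ.τ)]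

end Distance

/-! ### Input-to-state stability -/

lemma norm_le_hybridSupNorm {U : Type*} [NormedAddCommGroup U] {dom : Set (ℝ × ℕ)}
    {m : ℝ → ℕ → U} (hm : hybridSupNorm dom m ≠ ⊤) {t : ℝ} {j : ℕ} (h1 : (t, j) ∈ dom)
    (h2 : (t, j + 1) ∈ dom) : ‖m t j‖ ≤ (hybridSupNorm dom m).toReal := by
  rw [← toReal_enorm]
  refine ENNReal.toReal_mono hm (le_max_of_le_right ?_)
  exact le_iSup_of_le t (le_iSup_of_le j (le_iSup_of_le ⟨h1, h2⟩ le_rfl))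

lemma isClassK_const_mul {a : ℝ} (ha : 0 < a) : IsClassK fun r => a * r :=
  ⟨by fun_prop, fun _ _ _ _ h => mul_lt_mul_of_pos_left h ha, mul_zero a⟩

lemma isClassKL_exp {a b : ℝ} (ha : 0 < a) (hb : 0 < b) :
    IsClassKL fun r s => a * Real.exp (-b * s) * r := by
  refine ⟨by fun_prop, fun s _ => isClassK_const_mul (by positivity), fun r hr => ⟨?_, ?_⟩⟩
  · intro s _ s' _ h
    have : Real.exp (-b * s') ≤ Real.exp (-b * s) := Real.exp_le_exp.2 (by nlinarith)
    exact mul_le_mul_of_nonneg_right (mul_le_mul_of_nonneg_left this ha.le) hr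
  · have h1 : Filter.Tendsto (fun s : ℝ => Real.exp (-b * s)) Filter.atTop (nhds 0) :=
      Real.tendsto_exp_atBot.comp
        (Filter.tendsto_id.const_mul_atTop_of_neg (neg_neg_of_pos hb))
    simpa using (h1.const_mul a).mul_const r

lemma le_max_of_sq_le_sq_add_sq {x a b : ℝ} (ha : 0 ≤ a) (hb : 0 ≤ b)
    (h : 2 * x ^ 2 ≤ a ^ 2 + b ^ 2) : x ≤ max a b := by
  by_contra! hlt
  obtain ⟨h1, h2⟩ := max_lt_iff.1 hlt
  nlinarith

/-- Input-to-state stability from a Lyapunov function that decays exponentially along flows and grows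
at jumps by at most a multiple of the squared input, when a clock keeps the jumps apart. -/
theorem isISS_of_lyapunov {E U : Type*} [NormedAddCommGroup E] [NormedSpace ℝ E]
    [NormedAddCommGroup U] {H : HybridSystem E U} {A : Set E} (hC : IsClosed H.C)
    (hDC : H.D ⊆ H.C) (hGC : ∀ x ∈ H.D, ∀ u, H.G x u ⊆ H.C)
    {τ V : E → ℝ} {T₁ c δ C k : ℝ} (hT₁ : 0 < T₁) (hc : 0 < c) (hδ : 0 < δ) (hC0 : 0 < C)
    (hk : 0 < k) (hV : LocallyLipschitz V) (hflow : DecaysAlongFlow H V c)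
    (hbound : ∀ x ∈ H.C, δ * Metric.infDist x A ^ 2 ≤ V x ∧ V x ≤ C * Metric.infDist x A ^ 2)
    (hjump : ∀ x ∈ H.D, ∀ u, ∀ g ∈ H.G x u, V g ≤ V x + k * ‖u‖ ^ 2)
    (hτ : LocallyLipschitz τ)
    (hτflow : ∀ (x : ℝ → E) (u : U) (t : ℝ), x t ∈ H.C → HasDerivAt x (H.f (x t) u) t →
      HasDerivAt (fun s => τ (x s)) (-1) t)
    (hτD : ∀ x ∈ H.D, τ x = 0) (hτG : ∀ x ∈ H.D, ∀ u, ∀ g ∈ H.G x u, T₁ ≤ τ g) :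
    IsISS H A := by
  set q := Real.exp (-c * T₁) with hq
  have hq1 : 0 < 1 - q := by
    rw [sub_pos, hq, Real.exp_lt_one_iff, neg_mul, neg_neg_iff_pos]; positivity
  -- `b (t + j) ≤ c t + b`, because `j ≤ t / T₁ + 1`
  set b := c * T₁ / (1 + T₁) with hb
  have hb0 : 0 < b := by positivity
  have hbT : b * (1 + T₁) = c * T₁ := by rw [hb]; field_simp
  set a := √(2 * (C / δ) * Real.exp b) with ha
  set κ := √(2 * (k / (1 - q) / δ)) with hκ
  refine ⟨fun r s => a * Real.exp (-(b / 2) * s) * r, fun r => κ * r,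
    isClassKL_exp (by positivity) (by positivity), isClassK_const_mul (by positivity),
    fun dom φ m hs hm t j htj => ?_⟩
  set M := (hybridSupNorm dom m).toReal
  have hj : ∀ t j, (t, j) ∈ dom → (t, j + 1) ∈ dom →
      V (φ t (j + 1)) ≤ V (φ t j) + k * M ^ 2 := fun t j h1 h2 => by
    obtain ⟨hD, hG⟩ := hs.jump t j h1 h2
    refine (hjump _ hD _ _ hG).trans ?_
    gcongr
    exact norm_le_hybridSupNorm hm h1 h2
  obtain ⟨hCt, hjt, hVt⟩ := hs.lyapunov_bound hC hDC hGC hT₁ hc (by positivity) hV hflow hτ hτflow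
    hτD hτG hj htj
  have h00 : φ 0 0 ∈ H.C := by
    have := hs.init
    rw [hC.closure_eq] at this
    exact this.elim id fun h => hDC h
  have hV0 := (hbound _ h00).2
  have hVl := (hbound _ hCt).1
  have hD0 : 0 ≤ Metric.infDist (φ 0 0) A := Metric.infDist_nonneg
  generalize Metric.infDist (φ 0 0) A = D₀ at *
  generalize Metric.infDist (φ t j) A = D at *
  have hexp : Real.exp (-c * t) ≤ Real.exp b * Real.exp (-b * (t + j)) := by
    rw [← Real.exp_add, Real.exp_le_exp]
    have h1 : b * (j * T₁) ≤ b * (t + T₁) := mul_le_mul_of_nonneg_left hjt hb0.le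
    have h2 : T₁ * (b * (t + j)) ≤ T₁ * (c * t + b) := by linear_combination h1 + t * hbT
    linarith [le_of_mul_le_mul_left h2 hT₁]
  refine le_max_of_sq_le_sq_add_sq (by positivity) (mul_nonneg (Real.sqrt_nonneg _)
    ENNReal.toReal_nonneg) ?_
  rw [mul_pow, mul_pow, mul_pow, Real.sq_sqrt (by positivity), Real.sq_sqrt (by positivity),
    ← Real.exp_nat_mul, show ((2 : ℕ) : ℝ) * (-(b / 2) * (t + j)) = -b * (t + j) by push_cast; ring]
  have h1 : Real.exp (-c * t) * V (φ 0 0) ≤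
      Real.exp b * Real.exp (-b * (t + j)) * (C * D₀ ^ 2) :=
    (mul_le_mul_of_nonneg_left hV0 (Real.exp_pos _).le).trans
      (mul_le_mul_of_nonneg_right hexp (by positivity))
  have h2 : δ * D ^ 2 ≤ Real.exp b * Real.exp (-b * (t + j)) * (C * D₀ ^ 2) +
      k * M ^ 2 / (1 - q) := by linarith
  have h3 : 2 * (C / δ) * Real.exp b * Real.exp (-b * (t + j)) * D₀ ^ 2 +
      2 * (k / (1 - q) / δ) * M ^ 2 = 2 * ((Real.exp b * Real.exp (-b * (t + j)) * (C * D₀ ^ 2) +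
      k * M ^ 2 / (1 - q)) / δ) := by field_simp
  rw [h3]
  exact mul_le_mul_of_nonneg_left ((le_div_iff₀' hδ).2 h2) zero_le_two

end HyNTP

open HyNTP in
theorem theorem2 {d : ℕ} (G : Digraph (Fin (d + 1))) (hG : StronglyConnected G)
    (𝒯 : Matrix (Fin (d + 1)) (Fin (d + 1)) ℝ) (Lb : Matrix (Fin d) (Fin d) ℝ)
    (h𝒯 : IsReducingTransform G 𝒯 Lb)
    (T₁ T₂ μ h γ : ℝ) (hT₁ : 0 < T₁) (hT₂ : T₁ ≤ T₂) (hμ : 0 < μ) (hγ : 0 < γ)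
    (P₁ : Matrix (Idx2 d) (Idx2 d) ℝ) (P₂ : Matrix (Fin 2) (Fin 2) ℝ)
    (P₃ : Matrix (Idx2 d) (Idx2 d) ℝ)
    (hP₁ : P₁.PosDef) (hP₂ : P₂.PosDef) (hP₃ : P₃.PosDef)
    (ε β₁ β₂ κ₂ : ℝ) (hε : 0 < ε) (hβ₁ : 0 < β₁) (hβ₂ : 0 < β₂)
    (hlyap₂ : (-(β₁ • (1 : Matrix (Fin 2) (Fin 2) ℝ)) -
      (P₂ * Af₃ μ + (Af₃ μ).transpose * P₂)).PosSemidef)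
    (hlyap₃ : (-(β₂ • (1 : Matrix (Idx2 d) (Idx2 d) ℝ)) -
      (P₃ * Af₄ d μ + (Af₄ d μ).transpose * P₃)).PosSemidef)
    (hjump : ∀ ν ∈ Set.Icc T₁ T₂, (-jumpDiff h γ Lb P₁ ν).PosDef)
    (hκ₂ : κ₂ ∈ Set.Ioo 0 (kappa₂Bound T₁ T₂ h γ Lb P₁))
    (hcond : |Real.exp (kappaBar₁ T₂ h P₁ ε β₂ / alpha₂ T₂ h P₁ P₂ P₃ * T₂) *
      (1 - min 1 κ₂ / alpha₂ T₂ h P₁ P₂ P₃)| < 1) :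
    IsISS (noisySystem T₁ T₂ μ h γ Lb) (syncSet d T₂) := by
  obtain ⟨V, c, δ, C, k, hc, hδ, hC, hk, hV, hflow, hbound, hVjump⟩ :=
    exists_lyapunov (μ := μ) (h := h) (γ := γ) (Lb := Lb) hT₁ hT₂ hP₁ hP₂ hP₃ hβ₁ hβ₂ hlyap₂ hlyap₃
      hjump
  have hτ : ContDiff ℝ 1 (State.τ : State d → ℝ) := by unfold State.τ; fun_prop
  refine isISS_of_lyapunov (τ := State.τ) (isClosed_Icc.preimage hτ.continuous) (fun χ hχ => hχ.1)
    ?_ hT₁ hc hδ hC hk hV hflow (fun χ hχ => ?_) hVjump hτ.locallyLipschitz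
    (fun x u t _ hx => hasDerivAt_timer hx) (fun χ hχ => hχ.2) ?_
  · rintro χ - m g ⟨ν, hν, rfl⟩
    exact ⟨hT₁.le.trans hν.1, hν.2⟩
  · rw [infDist_syncSet_sq hχ]
    exact hbound χ hχ
  · rintro χ - m g ⟨ν, hν, rfl⟩
    exact hν.1
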